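/- Consider a sporadic task system $\tau_1,\dots,\tau_n$ with implicit deadlines: task $\tau_i$ has worst-case execution time $C_i>0$, minimum inter-release time (period) $T_i>0$, relative deadline $T_i$, and utilization $U_i=C_i/T_i$. The tasks are indexed by rate-monotonic priority, $T_1\le T_2\le\dots\le T_n$, a smaller index meaning a higher priority, and are scheduled by preemptive global fixed-priority scheduling (global RM) on $M\ge 1$ identical processors: at any time the $M$ highest-priority ready jobs are executed, jobs of one task being executed in sequence. Let $2\le k\le n$ and $U_k^{\max}=\max_{1\le j\le k}U_j$. Then task $\tau_k$ is schedulable (in every legal job sequence, each of its jobs finishes by its absolute deadline) if either $$\sum_{i=1}^{k-1}U_i\le M\quad\text{and}\quad U_k^{\max}\le 1-\frac{2}{M}\sum_{i=1}^{k-1}U_i+\frac{0.5}{M^2}\left(\Big(\sum_{i=1}^{k-1}U_i\Big)^2+\sum_{i=1}^{k-1}U_i^2\right),$$ or $$\frac{1}{M}\sum_{i=1}^{k-1}U_i\le\frac{k-1}{k}\left(2-\sqrt{2+2U_k^{\max}\frac{k}{k-1}}\right).$$ -/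

import Mathlib

open MeasureTheory

namespace GlobalSched

/-- A sporadic task: worst-case execution time `C`, relative deadline `D`, and period `T`
(the minimum time between two consecutive releases). -/
structure SporadicTask where
  C : ℝ
  D : ℝ
  T : ℝ
  C_pos : 0 < C
  D_pos : 0 < D
  T_pos : 0 < T

/-- The utilization `C / T` of a task. -/
noncomputable def SporadicTask.U (t : SporadicTask) : ℝ := t.C / t.T

/-- Implicit deadlines: relative deadline equal to period, for every task. -/
def ImplicitDeadlines {n : ℕ} (τ : Fin n → SporadicTask) : Prop :=
  ∀ i, (τ i).D = (τ i).T

/-- Throughout, a smaller index means a higher priority. The priorities are rate monotonic when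
the periods are non-decreasing in the index (equal periods being ordered by the index). -/
def RateMonotonic {n : ℕ} (τ : Fin n → SporadicTask) : Prop :=
  ∀ i j, i < j → (τ i).T ≤ (τ j).T

/-- The position `1, …, n` of a task in the priority order. -/
def rank {n : ℕ} (k : Fin n) : ℕ := (k : ℕ) + 1

/-- The largest utilization among the task `k` and the tasks of higher priority. -/
noncomputable def maxUtil {n : ℕ} (τ : Fin n → SporadicTask) (k : Fin n) : ℝ :=
  (Finset.Iic k).sup' ⟨k, Finset.mem_Iic.2 le_rfl⟩ (fun i => (τ i).U)

/-- A legal sequence of jobs of a sporadic task system. Job `(i, j)` is the `j`-th job of task `i`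
(`j = 0, 1, …`); it is released at `release i j` and needs `exec i j` units of execution, at most
the worst-case execution time of its task. (A job may need no execution at all, so a task that
releases only finitely many jobs, or none, is covered.) -/
structure JobSequence {n : ℕ} (τ : Fin n → SporadicTask) where
  release : Fin n → ℕ → ℝ
  exec : Fin n → ℕ → ℝ
  release_sep : ∀ i j, release i j + (τ i).T ≤ release i (j + 1)
  exec_nonneg : ∀ i j, 0 ≤ exec i j
  exec_le : ∀ i j, exec i j ≤ (τ i).C

/-- The absolute deadline of a job. -/
def JobSequence.deadline {n : ℕ} {τ : Fin n → SporadicTask} (ω : JobSequence τ)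
    (i : Fin n) (j : ℕ) : ℝ :=
  ω.release i j + (τ i).D

/-- A schedule on `M` identical processors: at every time each processor is idle (`none`) or
executes one job, and no job is executed by two processors at the same time. Preemption and
migration are unrestricted. -/
structure Schedule (n M : ℕ) where
  proc : Fin M → ℝ → Option (Fin n × ℕ)
  no_parallel : ∀ p q t J, proc p t = some J → proc q t = some J → p = q
  measurable_run : ∀ p J, MeasurableSet {t | proc p t = some J}

namespace Schedule

variable {n M : ℕ} {τ : Fin n → SporadicTask}

/-- Job `(i, j)` is being executed at time `t`. -/
def Runs (S : Schedule n M) (i : Fin n) (j : ℕ) (t : ℝ) : Prop :=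
  ∃ p, S.proc p t = some (i, j)

/-- The amount of execution that job `(i, j)` receives during `[a, b)`. -/
noncomputable def service (S : Schedule n M) (i : Fin n) (j : ℕ) (a b : ℝ) : ℝ :=
  volume.real {t | t ∈ Set.Ico a b ∧ S.Runs i j t}

/-- Job `(i, j)` has been released and has finished its execution by time `t`. -/
def Completed (S : Schedule n M) (ω : JobSequence τ) (i : Fin n) (j : ℕ) (t : ℝ) : Prop :=
  ω.release i j ≤ t ∧ ω.exec i j ≤ S.service i j (ω.release i j) t

/-- Job `(i, j)` is in the ready queue at time `t`: it is released and unfinished, and all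
earlier jobs of the same task are finished (jobs of one task are executed in sequence). -/
def Ready (S : Schedule n M) (ω : JobSequence τ) (i : Fin n) (j : ℕ) (t : ℝ) : Prop :=
  ω.release i j ≤ t ∧ ¬ S.Completed ω i j t ∧ ∀ j' < j, S.Completed ω i j' t

/-- Preemptive global fixed-priority scheduling: at any time the (at most) `M` highest-priority
jobs in the ready queue are executed. That is, only ready jobs are executed, and a ready job is
left waiting only when every processor executes a job of higher priority. -/
structure IsGlobalFixedPriority (S : Schedule n M) (ω : JobSequence τ) : Prop where
  ready_of_runs : ∀ i j t, S.Runs i j t → S.Ready ω i j t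
  all_busy_of_waiting : ∀ i j t, S.Ready ω i j t → ¬ S.Runs i j t →
    ∀ p, ∃ i' j', i' < i ∧ S.proc p t = some (i', j')

end Schedule

/-- Task `k` is schedulable by global fixed-priority scheduling on `M` processors: for every
legal job sequence, all its jobs finish by their absolute deadlines. -/
def Schedulable {n : ℕ} (τ : Fin n → SporadicTask) (M : ℕ) (k : Fin n) : Prop :=
  ∀ (ω : JobSequence τ) (S : Schedule n M), S.IsGlobalFixedPriority ω →
    ∀ j, S.Completed ω k j (ω.deadline k j)

end GlobalSched

/-! Let `ρ = maxUtil τ k` and suppose that a job of task `k` is the first of its task to miss its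
deadline. While it waits, all `M` processors do higher-priority work. Extend its window backwards to
the earliest time `s` from which that work has density at least `M (1 - ρ)` up to the release; let
`θ` be the length from `s` to the deadline. Then more than `M (t - ρ θ)` units of higher-priority
work are done in `[s, s + t)` for every `0 < t ≤ θ` (`exists_demand_of_miss`). Work carried in by a
task `i` busy since `s - φ i` is controlled because the density before `s` is low: task `i` has run
there at rate at least `ρ ≥ U i`.

Rate-monotonic periods are at most `θ`, so each task's demand is dominated by a constant plus one
jump at its last release point `r i`. Testing only `t = r i` and `t = θ`, and weighting by
utilizations, gives the negation of the quadratic condition (`quadratic_bound_of_demand`,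
`quadratic_bound_of_test_points`). The square-root condition reduces to the quadratic one by
Cauchy–Schwarz. -/

namespace GlobalSched

/-! ### Arithmetic of the utilization bounds. -/

/-- The quadratic utilization bound obtained from the test points `x i`, without ordering them. -/
theorem quadratic_bound_of_test_points {ι : Type*} [DecidableEq ι] (s : Finset ι) (u x : ι → ℝ)
    (ρ : ℝ) (hs : s.Nonempty) (hu : ∀ i ∈ s, 0 < u i)
    (hx : ∀ i ∈ s, x i < ρ + ∑ j ∈ s, u j * x j + ∑ j ∈ s with x j < x i, u j)
    (hend : 1 < ρ + ∑ j ∈ s, u j * x j + ∑ j ∈ s, u j) (hsum : ∑ j ∈ s, u j ≤ 1) :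
    1 - 2 * ∑ j ∈ s, u j + (1 / 2) * ((∑ j ∈ s, u j) ^ 2 + ∑ j ∈ s, u j ^ 2) < ρ := by
  set A := ∑ j ∈ s, u j * x j with hA
  set σ := ∑ j ∈ s, u j with hσ
  have h1 : A < ∑ i ∈ s, u i * (ρ + A + ∑ j ∈ s with x j < x i, u j) :=
    Finset.sum_lt_sum_of_nonempty hs fun i hi => mul_lt_mul_of_pos_left (hx i hi) (hu i hi)
  have h2 : ∑ i ∈ s, u i * (ρ + A + ∑ j ∈ s with x j < x i, u j)
      = σ * (ρ + A) + ∑ i ∈ s, ∑ j ∈ s, if x j < x i then u i * u j else 0 := by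
    simp only [mul_add, Finset.sum_add_distrib, Finset.sum_mul, hσ, Finset.sum_filter,
      Finset.mul_sum, mul_ite, mul_zero]
  set P := ∑ i ∈ s, ∑ j ∈ s, if x j < x i then u i * u j else 0 with hP
  have hP' : P = ∑ i ∈ s, ∑ j ∈ s, if x i < x j then u i * u j else 0 := by
    rw [hP, Finset.sum_comm]
    simp only [mul_comm]
  have hdiag : ∑ i ∈ s, u i ^ 2 = ∑ i ∈ s, ∑ j ∈ s, if i = j then u i * u j else 0 := by
    refine Finset.sum_congr rfl fun i hi => ?_
    rw [Finset.sum_ite_eq, if_pos hi, sq]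
  -- `P` and its transpose count each off-diagonal pair at most once (ties not at all), so no
  -- ordering of the `x i` matters.
  have h3 : P + P + ∑ i ∈ s, u i ^ 2 ≤ σ ^ 2 := by
    nth_rewrite 2 [hP']
    rw [hdiag, sq, hσ, Finset.sum_mul_sum, hP]
    simp only [← Finset.sum_add_distrib]
    refine Finset.sum_le_sum fun i hi => Finset.sum_le_sum fun j hj => ?_
    have := mul_pos (hu i hi) (hu j hj)
    split_ifs <;> first | linarith | (exfalso; first | order | (subst_vars; order))
  -- Eliminate `A`: `h1` bounds `(1 - σ) * A` above by `σ * ρ + P`, and `hend` times `1 - σ ≥ 0`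
  -- bounds it below by `(1 - σ) * (1 - ρ - σ)`.
  nlinarith [mul_nonneg (sub_nonneg.2 hsum) (sub_nonneg.2 hend.le)]

/-- The bound in terms of a demand function on `(0, θ]` in which every task is preceded by a
busy interval of length `φ i`. -/
theorem quadratic_bound_of_demand {ι : Type*} [DecidableEq ι] (s : Finset ι)
    (τ : ι → SporadicTask) (M ρ θ : ℝ) (φ : ι → ℝ) (hM : 0 < M) (hθ : 0 < θ) (hs : s.Nonempty)
    (hφ : ∀ i ∈ s, 0 ≤ φ i) (hT : ∀ i ∈ s, (τ i).T ≤ θ)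
    (hdem : ∀ t, 0 < t → t ≤ θ → M * (t - ρ * θ) <
      ∑ i ∈ s, (⌈(t + φ i) / (τ i).T⌉₊ * (τ i).C - (τ i).U * φ i))
    (hsum : ∑ i ∈ s, (τ i).U ≤ M) :
    1 - 2 / M * ∑ i ∈ s, (τ i).U
      + 0.5 / M ^ 2 * ((∑ i ∈ s, (τ i).U) ^ 2 + ∑ i ∈ s, (τ i).U ^ 2) < ρ := by
  -- `r i` is the last multiple of the period, shifted by `φ i`, not exceeding `θ`; it is positive
  -- because the period is at most `θ`.
  set q : ι → ℕ := fun i => ⌊(θ + φ i) / (τ i).T⌋₊ with hq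
  set r : ι → ℝ := fun i => q i * (τ i).T - φ i with hr
  have hUpos : ∀ i, 0 < (τ i).U := fun i => div_pos (τ i).C_pos (τ i).T_pos
  have hUT : ∀ i, (τ i).U * (τ i).T = (τ i).C := fun i =>
    div_mul_cancel₀ _ (τ i).T_pos.ne'
  have hrle : ∀ i ∈ s, r i ≤ θ := by
    intro i hi
    have h := Nat.floor_le (a := (θ + φ i) / (τ i).T)
      (div_nonneg (add_nonneg hθ.le (hφ i hi)) (τ i).T_pos.le)
    rw [le_div_iff₀ (τ i).T_pos] at h
    simp only [hr, hq]; linarith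
  have hrpos : ∀ i ∈ s, 0 < r i := by
    intro i hi
    have h := Nat.lt_floor_add_one ((θ + φ i) / (τ i).T)
    rw [div_lt_iff₀ (τ i).T_pos] at h
    have := hT i hi
    simp only [hr, hq]; linarith
  -- Up to `r i` the ceiling is at most `q i`; after it, one further job can count, and its cost is
  -- `C = U * T ≤ U * θ`.
  have hW : ∀ i ∈ s, ∀ t ≤ θ, (⌈(t + φ i) / (τ i).T⌉₊ * (τ i).C - (τ i).U * φ i)
      ≤ (τ i).U * r i + if r i < t then (τ i).U * θ else 0 := by
    intro i hi t ht
    have hCle : (τ i).C ≤ (τ i).U * θ := by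
      rw [← hUT i]; exact mul_le_mul_of_nonneg_left (hT i hi) (hUpos i).le
    have hUr : (τ i).U * r i = q i * (τ i).C - (τ i).U * φ i := by
      rw [← hUT i]; simp only [hr]; ring
    split_ifs with hlt
    · have : ⌈(t + φ i) / (τ i).T⌉₊ ≤ q i + 1 := by
        refine Nat.ceil_le.2 ?_
        push_cast
        refine le_trans ?_ (Nat.lt_floor_add_one ((θ + φ i) / (τ i).T)).le
        exact div_le_div_of_nonneg_right (by linarith) (τ i).T_pos.le
      have h' : (⌈(t + φ i) / (τ i).T⌉₊ : ℝ) ≤ q i + 1 := by exact_mod_cast this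
      have := mul_le_mul_of_nonneg_right h' (τ i).C_pos.le
      linarith
    · have : ⌈(t + φ i) / (τ i).T⌉₊ ≤ q i := by
        refine Nat.ceil_le.2 ?_
        rw [div_le_iff₀ (τ i).T_pos]
        have := not_lt.1 hlt
        simp only [hr] at this; linarith
      have h' : (⌈(t + φ i) / (τ i).T⌉₊ : ℝ) ≤ q i := by exact_mod_cast this
      have := mul_le_mul_of_nonneg_right h' (τ i).C_pos.le
      linarith
  have htest : ∀ t, 0 < t → t ≤ θ → t / θ < ρ + ∑ i ∈ s, (τ i).U / M * (r i / θ)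
      + ∑ i ∈ s with r i < t, (τ i).U / M := by
    intro t ht0 htθ
    have h1 := (hdem t ht0 htθ).trans_le (Finset.sum_le_sum fun i hi => hW i hi t htθ)
    rw [Finset.sum_add_distrib, ← Finset.sum_filter, ← Finset.sum_mul] at h1
    have e1 : ∑ i ∈ s, (τ i).U / M * (r i / θ) = (∑ i ∈ s, (τ i).U * r i) / (M * θ) := by
      rw [Finset.sum_div]
      exact Finset.sum_congr rfl fun i _ => div_mul_div_comm _ _ _ _
    have hMθ := mul_pos hM hθ
    rw [e1, ← Finset.sum_div]
    have : t / θ - ρ < ((∑ i ∈ s, (τ i).U * r i) + (∑ i ∈ s with r i < t, (τ i).U) * θ)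
        / (M * θ) := by
      rw [lt_div_iff₀ hMθ]
      refine lt_of_eq_of_lt ?_ h1
      field_simp
    have e2 : ((∑ i ∈ s, (τ i).U * r i) + (∑ i ∈ s with r i < t, (τ i).U) * θ) / (M * θ)
        = (∑ i ∈ s, (τ i).U * r i) / (M * θ) + (∑ i ∈ s with r i < t, (τ i).U) / M := by
      field_simp
    linarith
  have key := quadratic_bound_of_test_points s (fun i => (τ i).U / M) (fun i => r i / θ) ρ hs
    (fun i _ => div_pos (hUpos i) hM)
    (fun i hi => by
      have := htest (r i) (hrpos i hi) (hrle i hi)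
      simpa only [div_lt_div_iff_of_pos_right hθ] using this)
    (by
      have := htest θ hθ le_rfl
      rw [div_self hθ.ne'] at this
      refine this.trans_le (add_le_add_right ?_ _)
      exact Finset.sum_le_sum_of_subset_of_nonneg (Finset.filter_subset _ _)
        fun i _ _ => (div_pos (hUpos i) hM).le)
    (by rw [← Finset.sum_div]; exact (div_le_one hM).2 hsum)
  refine lt_of_eq_of_lt ?_ key
  simp only [div_pow, ← Finset.sum_div]
  ring

/-- The sufficient condition with the square root implies the quadratic one. -/
theorem quadratic_bound_of_sqrt_bound {ι : Type*} (s : Finset ι) (u : ι → ℝ) (M ρ : ℝ)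
    (hM : 0 < M) (hρ : 0 ≤ ρ) (hs : s.Nonempty) (hu : ∀ i ∈ s, 0 ≤ u i) {κ : ℝ}
    (hκ : κ = s.card + 1)
    (h : (∑ i ∈ s, u i) / M ≤ (κ - 1) / κ * (2 - √(2 + 2 * ρ * (κ / (κ - 1))))) :
    ∑ i ∈ s, u i ≤ M ∧ ρ ≤ 1 - 2 / M * ∑ i ∈ s, u i
      + 0.5 / M ^ 2 * ((∑ i ∈ s, u i) ^ 2 + ∑ i ∈ s, u i ^ 2) := by
  have hm : (0 : ℝ) < s.card := by exact_mod_cast hs.card_pos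
  have hcs : (∑ i ∈ s, u i) ^ 2 ≤ s.card * ∑ i ∈ s, u i ^ 2 := sq_sum_le_card_mul_sum_sq
  have hσ0 : 0 ≤ ∑ i ∈ s, u i := Finset.sum_nonneg hu
  set σ := ∑ i ∈ s, u i
  set Q := ∑ i ∈ s, u i ^ 2
  subst hκ
  generalize (s.card : ℝ) = m at *
  rw [add_sub_cancel_right] at h
  set w := √(2 + 2 * ρ * ((m + 1) / m)) with hw
  have hin : (0 : ℝ) ≤ 2 * ρ * ((m + 1) / m) := by positivity
  have hw2 : w ^ 2 = 2 + 2 * ρ * ((m + 1) / m) := Real.sq_sqrt (by linarith)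
  have hw0 : 0 ≤ w := Real.sqrt_nonneg _
  have hw1 : 1 ≤ w := by nlinarith
  obtain ⟨v, hv⟩ : ∃ v, v = σ / M := ⟨_, rfl⟩
  obtain ⟨z, hz⟩ : ∃ z, z = Q / M ^ 2 := ⟨_, rfl⟩
  have hv0 : 0 ≤ v := hv ▸ div_nonneg hσ0 hM.le
  have hzv : v ^ 2 ≤ m * z := by
    rw [hv, hz, div_pow, mul_div_assoc']
    exact div_le_div_of_nonneg_right hcs (by positivity)
  rw [← hv, div_mul_eq_mul_div, le_div_iff₀ (by positivity)] at h
  have hv1 : v ≤ 1 := by nlinarith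
  have hρw : 2 * ρ * (m + 1) = m * (w ^ 2 - 2) := by
    rw [hw2]; field_simp; ring
  refine ⟨by rw [hv, div_le_one hM] at hv1; exact hv1, ?_⟩
  -- Since `z ≥ v ^ 2 / m`, it suffices to bound a quadratic in `v` alone, whose smaller root is the
  -- square-root expression.
  have goal' : ρ ≤ 1 - 2 * v + 1 / 2 * (v ^ 2 + z) := by
    have h1 : m * w ≤ 2 * m - v * (m + 1) := by linarith
    have h2 : (m * w) ^ 2 ≤ (2 * m - v * (m + 1)) ^ 2 :=
      pow_le_pow_left₀ (by positivity) h1 2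
    have h3 : 2 * ρ * (m + 1) * m ≤ 2 * m ^ 2 - 4 * m * v * (m + 1) + v ^ 2 * (m + 1) ^ 2 := by
      rw [hρw]; nlinarith
    have h4 : 2 * m * (m + 1) * ρ
        ≤ 2 * m * (m + 1) * (1 - 2 * v + 1 / 2 * (v ^ 2 + z)) := by
      have := mul_le_mul_of_nonneg_left hzv (by positivity : 0 ≤ m + 1)
      nlinarith
    exact le_of_mul_le_mul_left h4 (by positivity)
  refine goal'.trans_eq ?_
  rw [hv, hz]
  ring

/-! ### Time occupied by a set of instants. -/

/-- The time during `[a, b)` that belongs to `A`. -/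
noncomputable def occupation (A : Set ℝ) (a b : ℝ) : ℝ := volume.real (Set.Ico a b ∩ A)

theorem occupation_nonneg (A : Set ℝ) (a b : ℝ) : 0 ≤ occupation A a b := measureReal_nonneg

theorem volume_Ico_inter_ne_top (A : Set ℝ) (a b : ℝ) : volume (Set.Ico a b ∩ A) ≠ ⊤ :=
  measure_ne_top_of_subset Set.inter_subset_left measure_Ico_lt_top.ne

theorem occupation_le (A : Set ℝ) {a b : ℝ} (hab : a ≤ b) : occupation A a b ≤ b - a := by
  have : volume.real (Set.Ico a b) = b - a := by
    rw [Real.volume_real_Ico, max_eq_left (sub_nonneg.2 hab)]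
  rw [← this]
  exact measureReal_mono Set.inter_subset_left measure_Ico_lt_top.ne

theorem occupation_mono_set {A B : Set ℝ} {a b c d : ℝ}
    (h : Set.Ico a b ∩ A ⊆ Set.Ico c d ∩ B) : occupation A a b ≤ occupation B c d :=
  measureReal_mono h (volume_Ico_inter_ne_top _ _ _)

theorem occupation_eq_zero {A : Set ℝ} {a b : ℝ} (h : ∀ t ∈ Set.Ico a b, t ∉ A) :
    occupation A a b = 0 := by
  have : Set.Ico a b ∩ A = ∅ := Set.eq_empty_of_forall_notMem fun t ht => h t ht.1 ht.2
  rw [occupation, this, measureReal_empty]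

theorem occupation_add {A : Set ℝ} (hA : MeasurableSet A) {a b c : ℝ} (hab : a ≤ b)
    (hbc : b ≤ c) : occupation A a b + occupation A b c = occupation A a c := by
  unfold occupation
  rw [← Set.Ico_union_Ico_eq_Ico hab hbc, Set.union_inter_distrib_right]
  refine (measureReal_union ?_ (measurableSet_Ico.inter hA)
    (volume_Ico_inter_ne_top _ _ _) (volume_Ico_inter_ne_top _ _ _)).symm
  exact Set.disjoint_left.2 fun t h1 h2 => absurd h1.1.2 (not_lt.2 h2.1.1)

theorem occupation_compl {A : Set ℝ} (hA : MeasurableSet A) {a b : ℝ} (hab : a ≤ b) :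
    occupation Aᶜ a b = b - a - occupation A a b := by
  have h := measureReal_inter_add_sdiff (μ := volume) (s := Set.Ico a b) hA measure_Ico_lt_top.ne
  rw [Real.volume_real_Ico, max_eq_left (sub_nonneg.2 hab), Set.sdiff_eq] at h
  unfold occupation
  linarith

/-- Moving an endpoint changes the occupation by at most the distance moved, so it is 1-Lipschitz.
-/
theorem continuousOn_occupation_right {A : Set ℝ} (hA : MeasurableSet A) (a : ℝ) :
    ContinuousOn (fun t => occupation A a t) (Set.Ici a) := by
  refine LipschitzOnWith.continuousOn (K := 1) (LipschitzOnWith.of_le_add fun x hx y hy => ?_)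
  rcases le_total x y with h | h
  · have := occupation_add hA (Set.mem_Ici.1 hx) h
    have := occupation_nonneg A x y
    have := dist_nonneg (x := x) (y := y)
    linarith
  · have := occupation_add hA (Set.mem_Ici.1 hy) h
    have := occupation_le A h
    rw [Real.dist_eq, abs_of_nonneg (sub_nonneg.2 h)]
    linarith

theorem continuousOn_occupation_left {A : Set ℝ} (hA : MeasurableSet A) (b : ℝ) :
    ContinuousOn (fun t => occupation A t b) (Set.Iic b) := by
  refine LipschitzOnWith.continuousOn (K := 1) (LipschitzOnWith.of_le_add fun x hx y hy => ?_)
  rcases le_total y x with h | h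
  · have := occupation_add hA h (Set.mem_Iic.1 hx)
    have := occupation_nonneg A y x
    have := dist_nonneg (x := x) (y := y)
    linarith
  · have := occupation_add hA h (Set.mem_Iic.1 hy)
    have := occupation_le A h
    rw [Real.dist_eq, abs_of_nonpos (sub_nonpos.2 h)]
    linarith

/-- If every time in `A` lies in at least `m` of the sets `B i`, the sets `B i` together occupy
at least `m` times as much time as `A`. -/
theorem mul_occupation_le_sum {ι : Type*} (s : Finset ι) (A : Set ℝ) (B : ι → Set ℝ)
    (hA : MeasurableSet A) (hB : ∀ i, MeasurableSet (B i)) (m : ℕ) (a b : ℝ)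
    [∀ t, DecidablePred fun i => t ∈ B i]
    (h : ∀ t ∈ Set.Ico a b ∩ A, m ≤ (s.filter fun i => t ∈ B i).card) :
    m * occupation A a b ≤ ∑ i ∈ s, occupation (B i) a b := by
  set X := Set.Ico a b ∩ A with hX
  have hXm : MeasurableSet X := measurableSet_Ico.inter hA
  have key : (m : ENNReal) * volume X ≤ ∑ i ∈ s, volume (Set.Ico a b ∩ B i) := by
    -- Integrate over `X` the number of sets `B i` containing the instant.
    calc (m : ENNReal) * volume X = ∫⁻ _ in X, (m : ENNReal) := by
          rw [setLIntegral_const]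
      _ ≤ ∫⁻ t in X, ∑ i ∈ s, (B i).indicator 1 t := by
          refine setLIntegral_mono' hXm fun t ht => ?_
          simp only [Set.indicator_apply, Pi.one_apply, Finset.sum_boole]
          exact_mod_cast h t ht
      _ = ∑ i ∈ s, ∫⁻ t in X, (B i).indicator 1 t :=
          lintegral_finsetSum _ fun i _ => measurable_one.indicator (hB i)
      _ ≤ ∑ i ∈ s, volume (Set.Ico a b ∩ B i) := by
          refine Finset.sum_le_sum fun i _ => ?_
          rw [lintegral_indicator_one (hB i), Measure.restrict_apply (hB i)]
          exact measure_mono fun t ht => ⟨ht.2.1, ht.1⟩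
  have hfin : ∑ i ∈ s, volume (Set.Ico a b ∩ B i) ≠ ⊤ :=
    ENNReal.sum_ne_top.2 fun i _ => volume_Ico_inter_ne_top _ _ _
  have := ENNReal.toReal_mono hfin key
  rw [ENNReal.toReal_mul, ENNReal.toReal_natCast,
    ENNReal.toReal_sum fun i _ => volume_Ico_inter_ne_top _ _ _] at this
  exact this

/-! ### Releases, backlog and interference under global fixed priority. -/

namespace JobSequence

variable {n : ℕ} {τ : Fin n → SporadicTask}

theorem release_add_le (ω : JobSequence τ) (i : Fin n) (m d : ℕ) :
    ω.release i m + d * (τ i).T ≤ ω.release i (m + d) := by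
  induction d with
  | zero => simp
  | succ d ih =>
    have := ω.release_sep i (m + d)
    rw [← add_assoc]
    push_cast
    linarith

theorem release_mono (ω : JobSequence τ) (i : Fin n) : Monotone (ω.release i) :=
  monotone_nat_of_le_succ fun j => by
    have := ω.release_sep i j
    have := (τ i).T_pos
    linarith

theorem exists_lt_release (ω : JobSequence τ) (i : Fin n) (t : ℝ) : ∃ j, t < ω.release i j := by
  obtain ⟨d, hd⟩ := exists_nat_gt ((t - ω.release i 0) / (τ i).T)
  rw [div_lt_iff₀ (τ i).T_pos] at hd
  have := ω.release_add_le i 0 d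
  rw [zero_add] at this
  exact ⟨d, by linarith⟩

end JobSequence

namespace Schedule

variable {n M : ℕ} {τ : Fin n → SporadicTask}

/-- The times at which task `i` executes. -/
def taskRun (S : Schedule n M) (i : Fin n) : Set ℝ := {t | ∃ j, S.Runs i j t}

theorem measurableSet_runs (S : Schedule n M) (i : Fin n) (j : ℕ) :
    MeasurableSet {t | S.Runs i j t} := by
  have : {t | S.Runs i j t} = ⋃ p, {t | S.proc p t = some (i, j)} := by
    ext t; simp [Runs]
  rw [this]
  exact MeasurableSet.iUnion fun p => S.measurable_run p _

theorem measurableSet_taskRun (S : Schedule n M) (i : Fin n) : MeasurableSet (S.taskRun i) := by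
  have : S.taskRun i = ⋃ j, {t | S.Runs i j t} := by
    ext t; simp [taskRun]
  rw [this]
  exact MeasurableSet.iUnion fun j => S.measurableSet_runs i j

theorem service_eq_occupation (S : Schedule n M) (i : Fin n) (j : ℕ) (a b : ℝ) :
    S.service i j a b = occupation {t | S.Runs i j t} a b := rfl

/-- The execution that the tasks of higher priority than `k` receive during `[a, b)`. -/
noncomputable def hpWork (S : Schedule n M) (k : Fin n) (a b : ℝ) : ℝ :=
  ∑ i ∈ Finset.Iio k, occupation (S.taskRun i) a b

theorem hpWork_add (S : Schedule n M) (k : Fin n) {a b c : ℝ} (hab : a ≤ b) (hbc : b ≤ c) :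
    S.hpWork k a b + S.hpWork k b c = S.hpWork k a c := by
  unfold hpWork
  rw [← Finset.sum_add_distrib]
  exact Finset.sum_congr rfl fun i _ => occupation_add (S.measurableSet_taskRun i) hab hbc

variable {S : Schedule n M} {ω : JobSequence τ}

theorem Completed.mono {i : Fin n} {j : ℕ} {s t : ℝ} (h : S.Completed ω i j s) (hst : s ≤ t) :
    S.Completed ω i j t :=
  ⟨h.1.trans hst, h.2.trans <| by
    rw [service_eq_occupation, service_eq_occupation]
    exact occupation_mono_set fun x hx => ⟨⟨hx.1.1, hx.1.2.trans_le hst⟩, hx.2⟩⟩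

theorem Ready.unique {i : Fin n} {j j' : ℕ} {t : ℝ} (h : S.Ready ω i j t)
    (h' : S.Ready ω i j' t) : j = j' := by
  rcases lt_trichotomy j j' with hlt | heq | hlt
  · exact absurd (h'.2.2 j hlt) h.2.1
  · exact heq
  · exact absurd (h.2.2 j' hlt) h'.2.1

/-- Some job of task `i` is in the ready queue at time `t`. -/
def Pending (S : Schedule n M) (ω : JobSequence τ) (i : Fin n) (t : ℝ) : Prop :=
  ∃ j, S.Ready ω i j t

/-- The first released unfinished job of a task would be ready. -/
theorem completed_of_not_pending {i : Fin n} {t : ℝ} (h : ¬ S.Pending ω i t) (j : ℕ)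
    (hj : ω.release i j ≤ t) : S.Completed ω i j t := by
  induction j using Nat.strong_induction_on with
  | _ j ih =>
    by_contra hc
    exact h ⟨j, hj, hc, fun l hl => ih l hl ((ω.release_mono i hl.le).trans hj)⟩

/-- A job executes only until it has received its execution demand. -/
theorem IsGlobalFixedPriority.service_le_exec (hS : S.IsGlobalFixedPriority ω) (i : Fin n)
    (j : ℕ) (t : ℝ) : S.service i j (ω.release i j) t ≤ ω.exec i j := by
  rcases lt_or_ge t (ω.release i j) with hlt | hle
  · rw [service_eq_occupation, occupation_eq_zero]
    · exact ω.exec_nonneg i j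
    · intro x hx
      exact absurd (hx.1.trans_lt hx.2) hlt.asymm
  by_contra! hc
  have hm := S.measurableSet_runs i j
  have h0 : occupation {t | S.Runs i j t} (ω.release i j) (ω.release i j) = 0 :=
    occupation_eq_zero fun x hx => absurd (hx.1.trans_lt hx.2) (lt_irrefl _)
  -- At the instant `x` where the service equals the demand the job is complete, so it never runs
  -- afterwards.
  obtain ⟨x, hx, hxe⟩ := intermediate_value_Icc hle
    ((continuousOn_occupation_right hm (ω.release i j)).mono Set.Icc_subset_Ici_self)
    (show ω.exec i j ∈ Set.Icc _ _ from ⟨by rw [h0]; exact ω.exec_nonneg i j, hc.le⟩)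
  have hcomp : S.Completed ω i j x := ⟨hx.1, hxe.ge⟩
  have hz : occupation {t | S.Runs i j t} x t = 0 := occupation_eq_zero fun y hy hr =>
    (hS.ready_of_runs i j y hr).2.1 (hcomp.mono hy.1)
  have := occupation_add hm hx.1 hx.2
  rw [service_eq_occupation] at hc
  simp only at hxe
  linarith

/-- While a task of priority at least that of `k` is pending but does not execute, all `M`
processors execute tasks of higher priority than `k`. -/
theorem IsGlobalFixedPriority.mul_waiting_le_hpWork (hS : S.IsGlobalFixedPriority ω)
    {i k : Fin n} (hik : i ≤ k) {a b : ℝ} (hab : a ≤ b)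
    (hp : ∀ t ∈ Set.Ico a b, S.Pending ω i t) :
    M * (b - a - occupation (S.taskRun i) a b) ≤ S.hpWork k a b := by
  classical
  rw [← occupation_compl (S.measurableSet_taskRun i) hab]
  refine mul_occupation_le_sum _ _ _ (S.measurableSet_taskRun i).compl
    S.measurableSet_taskRun M a b fun t ht => ?_
  obtain ⟨j, hj⟩ := hp t ht.1
  have hbusy := hS.all_busy_of_waiting i j t hj fun hr => ht.2 ⟨j, hr⟩
  choose f g hf hfg using hbusy
  -- Distinct processors serve distinct tasks: a task has only one ready job at a time, and a job
  -- occupies only one processor.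
  have hinj : Function.Injective f := by
    intro p q hpq
    have h1 := hS.ready_of_runs _ _ t ⟨p, hfg p⟩
    have h2 := hS.ready_of_runs _ _ t ⟨q, hfg q⟩
    rw [← hpq] at h2
    have hg : g p = g q := h1.unique h2
    exact S.no_parallel p q t _ (hfg p) (by rw [hfg q, hpq, hg])
  calc M = (Finset.univ.image f).card := by
        rw [Finset.card_image_of_injective _ hinj, Finset.card_univ, Fintype.card_fin]
    _ ≤ _ := by
        refine Finset.card_le_card fun l hl => ?_
        obtain ⟨p, -, rfl⟩ := Finset.mem_image.1 hl
        exact Finset.mem_filter.2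
          ⟨Finset.mem_Iio.2 ((hf p).trans_le hik), g p, p, hfg p⟩

/-- The execution of a task from a time `a` on at which it has no backlog. -/
theorem IsGlobalFixedPriority.taskRun_le_of_no_backlog (hS : S.IsGlobalFixedPriority ω)
    {i : Fin n} {m : ℕ} {a : ℝ} (hm : ∀ l < m, S.Completed ω i l a) (ha : a ≤ ω.release i m)
    (t : ℝ) : occupation (S.taskRun i) a t ≤ ⌈(t - a) / (τ i).T⌉₊ * (τ i).C := by
  set N := ⌈(t - a) / (τ i).T⌉₊ with hN
  -- Jobs before `m` are already complete at `a`, and job `m + d` is released no earlier than `a + d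
  -- * T`.
  have hsub : Set.Ico a t ∩ S.taskRun i ⊆
      ⋃ d ∈ Finset.range N, Set.Ico (ω.release i (m + d)) t ∩ {x | S.Runs i (m + d) x} := by
    rintro x ⟨hx, l, hl⟩
    have hrdy := hS.ready_of_runs i l x hl
    have hml : m ≤ l := by
      by_contra! hlt
      exact hrdy.2.1 ((hm l hlt).mono hx.1)
    obtain ⟨d, rfl⟩ := Nat.exists_eq_add_of_le hml
    have h1 := ω.release_add_le i m d
    have h2 := hrdy.1
    have hd : d < N := by
      rw [hN, Nat.lt_ceil, lt_div_iff₀ (τ i).T_pos]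
      linarith [hx.2]
    exact Set.mem_biUnion (Finset.mem_coe.2 (Finset.mem_range.2 hd)) ⟨⟨h2, hx.2⟩, hl⟩
  have hfin : volume (⋃ d ∈ Finset.range N,
      Set.Ico (ω.release i (m + d)) t ∩ {x | S.Runs i (m + d) x}) ≠ ⊤ :=
    ((measure_biUnion_finset_le _ _).trans_lt (ENNReal.sum_lt_top.2 fun d _ =>
      (volume_Ico_inter_ne_top _ _ _).lt_top)).ne
  calc occupation (S.taskRun i) a t ≤ _ := measureReal_mono hsub hfin
    _ ≤ ∑ d ∈ Finset.range N,
        volume.real (Set.Ico (ω.release i (m + d)) t ∩ {x | S.Runs i (m + d) x}) :=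
        measureReal_biUnion_finset_le _ _
    _ ≤ ∑ _d ∈ Finset.range N, (τ i).C := Finset.sum_le_sum fun d _ =>
        (hS.service_le_exec i (m + d) t).trans (ω.exec_le i (m + d))
    _ = N * (τ i).C := by rw [Finset.sum_const, Finset.card_range, nsmul_eq_mul]

/-- Before every time there is a start of a busy interval of task `i`, possibly empty. -/
theorem exists_busy_start (S : Schedule n M) (ω : JobSequence τ) (i : Fin n) (b : ℝ) :
    ∃ a ≤ b, ∃ m, (∀ l < m, S.Completed ω i l a) ∧ a ≤ ω.release i m ∧
      ∀ t ∈ Set.Ico a b, S.Pending ω i t := by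
  classical
  by_cases hp : S.Pending ω i b
  · obtain ⟨j, hj⟩ := hp
    set P : ℕ → Prop := fun m => ∀ l < m, S.Completed ω i l (ω.release i m) with hP
    have hP0 : P 0 := fun l hl => absurd hl (Nat.not_lt_zero l)
    set m := Nat.findGreatest P j with hmdef
    have hPm : P m := Nat.findGreatest_spec (Nat.zero_le j) hP0
    have hmj : m ≤ j := Nat.findGreatest_le j
    refine ⟨ω.release i m, (ω.release_mono i hmj).trans hj.1, m, hPm, le_rfl, fun t ht => ?_⟩
    -- If nothing were pending at `t`, the first job released after `t` would satisfy `P`,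
    -- contradicting the maximality of `m`.
    by_contra hnp
    have hjt : t < ω.release i j := by
      by_contra! hle
      exact hj.2.1 ((completed_of_not_pending hnp j hle).mono ht.2.le)
    have hex := ω.exists_lt_release i t
    set l := Nat.find hex with hl
    have hlt : t < ω.release i l := Nat.find_spec hex
    have hlj : l ≤ j := Nat.find_min' hex hjt
    have hPl : P l := fun l' hl' =>
      (completed_of_not_pending hnp l' (not_lt.1 (Nat.find_min hex hl'))).mono hlt.le
    have hlm : l ≤ m := Nat.le_findGreatest hlj hPl
    exact absurd (ω.release_mono i hlm) (not_le.2 (ht.1.trans_lt hlt))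
  · have hex := ω.exists_lt_release i b
    exact ⟨b, le_rfl, Nat.find hex,
      fun l hl => completed_of_not_pending hp l (not_lt.1 (Nat.find_min hex hl)),
      (Nat.find_spec hex).le, fun t ht => absurd (ht.1.trans_lt ht.2) (lt_irrefl _)⟩

end Schedule

/-! ### Extending the window of a missed deadline. -/

namespace Schedule

variable {n M : ℕ} {τ : Fin n → SporadicTask} {S : Schedule n M} {ω : JobSequence τ}

/-- At most `M` tasks execute at any time. -/
theorem hpWork_le (S : Schedule n M) (k : Fin n) {a b : ℝ} (hab : a ≤ b) :
    S.hpWork k a b ≤ M * (b - a) := by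
  set R : Fin M → Fin n → Set ℝ := fun p i => ⋃ j, {t | S.proc p t = some (i, j)} with hR
  have hRm : ∀ p i, MeasurableSet (R p i) := fun p i =>
    MeasurableSet.iUnion fun j => S.measurable_run p _
  have hrun : ∀ i, occupation (S.taskRun i) a b ≤ ∑ p, occupation (R p i) a b := by
    intro i
    have : Set.Ico a b ∩ S.taskRun i = ⋃ p, Set.Ico a b ∩ R p i := by
      ext t
      simp only [taskRun, Runs, hR, Set.mem_inter_iff, Set.mem_ofPred_eq, Set.mem_iUnion]
      grind
    unfold occupation
    rw [this]
    exact measureReal_iUnion_fintype_le _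
  have hproc : ∀ p, ∑ i ∈ Finset.Iio k, occupation (R p i) a b ≤ b - a := by
    intro p
    have hdisj : Set.PairwiseDisjoint (↑(Finset.Iio k)) fun i => Set.Ico a b ∩ R p i := by
      intro i _ i' _ hne
      refine Set.disjoint_left.2 fun t ht ht' => hne ?_
      obtain ⟨j, hj⟩ := Set.mem_iUnion.1 ht.2
      obtain ⟨j', hj'⟩ := Set.mem_iUnion.1 ht'.2
      have := hj.symm.trans hj'
      simp only [Option.some.injEq, Prod.mk.injEq] at this
      exact this.1
    have := measureReal_biUnion_finset (μ := volume) hdisj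
      (fun i _ => measurableSet_Ico.inter (hRm p i)) fun i _ => volume_Ico_inter_ne_top _ _ _
    unfold occupation
    rw [← this, ← Set.inter_iUnion₂]
    exact occupation_le _ hab
  calc S.hpWork k a b ≤ ∑ i ∈ Finset.Iio k, ∑ p, occupation (R p i) a b :=
        Finset.sum_le_sum fun i _ => hrun i
    _ = ∑ p, ∑ i ∈ Finset.Iio k, occupation (R p i) a b := Finset.sum_comm
    _ ≤ ∑ _p : Fin M, (b - a) := Finset.sum_le_sum fun p _ => hproc p
    _ = M * (b - a) := by rw [Finset.sum_const, Finset.card_univ, Fintype.card_fin, nsmul_eq_mul]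

theorem continuousOn_hpWork_left (S : Schedule n M) (k : Fin n) (b : ℝ) :
    ContinuousOn (fun t => S.hpWork k t b) (Set.Iic b) :=
  continuousOn_finsetSum _ fun i _ => continuousOn_occupation_left (S.measurableSet_taskRun i) b

/-- No task runs before its first release; this keeps the earliest dense time finite. -/
theorem IsGlobalFixedPriority.hpWork_bounded (hS : S.IsGlobalFixedPriority ω) (k : Fin n)
    (b : ℝ) : ∃ K, ∀ t, S.hpWork k t b ≤ K := by
  refine ⟨∑ i ∈ Finset.Iio k, occupation (S.taskRun i) (ω.release i 0) b, fun t =>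
    Finset.sum_le_sum fun i _ => occupation_mono_set ?_⟩
  rintro x ⟨hx, l, hl⟩
  exact ⟨⟨(ω.release_mono i (Nat.zero_le l)).trans (hS.ready_of_runs i l x hl).1, hx.2⟩, l, hl⟩

/-- The earliest time from which on the tasks of higher priority than `k` receive at least the
rate `c` of execution up to time `b`. -/
theorem IsGlobalFixedPriority.exists_earliest_dense (hS : S.IsGlobalFixedPriority ω)
    (k : Fin n) (b : ℝ) {c : ℝ} (hc : 0 < c) :
    ∃ s ≤ b, c * (b - s) ≤ S.hpWork k s b ∧ ∀ r < s, S.hpWork k r b < c * (b - r) := by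
  set D : Set ℝ := Set.Iic b ∩ (fun t => S.hpWork k t b - c * (b - t)) ⁻¹' Set.Ici 0 with hD
  have hclosed : IsClosed D :=
    ((S.continuousOn_hpWork_left k b).sub (by fun_prop)).preimage_isClosed_of_isClosed
      isClosed_Iic isClosed_Ici
  have hne : D.Nonempty := ⟨b, Set.self_mem_Iic, by
    simp only [Set.mem_preimage, Set.mem_Ici, sub_self, mul_zero, sub_zero]
    exact Finset.sum_nonneg fun i _ => occupation_nonneg _ _ _⟩
  obtain ⟨K, hK⟩ := hS.hpWork_bounded k b
  have hbdd : BddBelow D := ⟨b - K / c, fun t ht => by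
    have h1 : 0 ≤ S.hpWork k t b - c * (b - t) := ht.2
    have h2 : b - t ≤ K / c := by
      rw [le_div_iff₀ hc]
      linarith [hK t]
    linarith⟩
  have hmem := hclosed.csInf_mem hne hbdd
  refine ⟨sInf D, hmem.1, sub_nonneg.1 hmem.2, fun r hr => ?_⟩
  by_contra! hle
  exact notMem_of_lt_csInf hr hbdd ⟨hr.le.trans hmem.1, sub_nonneg.2 hle⟩

/-- A missed deadline of task `k` forces a long interval in which the demand of the tasks of
higher priority is large at every intermediate time. -/
theorem IsGlobalFixedPriority.exists_demand_of_miss (hS : S.IsGlobalFixedPriority ω)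
    (hM : 0 < M) {k : Fin n} {j : ℕ} {ρ : ℝ} (hρ : ∀ i ≤ k, (τ i).U ≤ ρ) (hρ1 : ρ < 1)
    (hprev : ∀ l < j, S.Completed ω k l (ω.release k j))
    (hmiss : ¬ S.Completed ω k j (ω.release k j + (τ k).T)) :
    ∃ θ ≥ (τ k).T, ∃ φ : Fin n → ℝ, (∀ i, 0 ≤ φ i) ∧ ∀ t, 0 < t → t ≤ θ →
      M * (t - ρ * θ) <
        ∑ i ∈ Finset.Iio k, (⌈(t + φ i) / (τ i).T⌉₊ * (τ i).C - (τ i).U * φ i) := by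
  have hM' : (0 : ℝ) < M := by exact_mod_cast hM
  have hTk := (τ k).T_pos
  set b := ω.release k j with hb
  have hready : ∀ t ∈ Set.Ico b (b + (τ k).T), S.Ready ω k j t := fun t ht =>
    ⟨ht.1, fun h => hmiss (h.mono ht.2.le), fun l hl => (hprev l hl).mono ht.1⟩
  have hexec : occupation (S.taskRun k) b (b + (τ k).T) < (τ k).C := by
    refine lt_of_le_of_lt (occupation_mono_set (B := {t | S.Runs k j t}) ?_)
      ((not_le.1 fun h => hmiss ⟨by linarith, h⟩).trans_le (ω.exec_le k j))
    rintro x ⟨hx, l, hl⟩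
    have := (hS.ready_of_runs k l x hl).unique (hready x hx)
    exact ⟨hx, this ▸ hl⟩
  have hCk : (τ k).C ≤ ρ * (τ k).T := (div_le_iff₀ hTk).1 (hρ k le_rfl)
  -- The late job runs for less than `C ≤ ρ * T` and waits the rest of the time.
  have hwait : ∀ t, b ≤ t → t ≤ b + (τ k).T →
      M * (t - b - ρ * (τ k).T) < S.hpWork k b t := by
    intro t hbt ht
    have h1 : M * (t - b - occupation (S.taskRun k) b t) ≤ S.hpWork k b t :=
      hS.mul_waiting_le_hpWork le_rfl hbt fun x hx => ⟨j, hready x ⟨hx.1, hx.2.trans_le ht⟩⟩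
    have h2 : occupation (S.taskRun k) b t < (τ k).C := by
      refine lt_of_le_of_lt ?_ hexec
      have := occupation_add (S.measurableSet_taskRun k) hbt ht
      linarith [occupation_nonneg (S.taskRun k) t (b + (τ k).T)]
    refine lt_of_lt_of_le ?_ h1
    exact mul_lt_mul_of_pos_left (by linarith) hM'
  obtain ⟨s, hsb, hs, hearly⟩ :=
    hS.exists_earliest_dense k b (c := M * (1 - ρ)) (mul_pos hM' (by linarith))
  -- After `b`, add the dense work on `[s, b)` to `hwait`. Before `b`, subtract from it at most full
  -- capacity on `[u, b)`; the slack `M * ρ * T` makes that case strict.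
  have hρT : 0 < ρ * (τ k).T := (τ k).C_pos.trans_le hCk
  have hdemand : ∀ u, s ≤ u → u ≤ b + (τ k).T →
      M * (u - s - ρ * (b + (τ k).T - s)) < S.hpWork k s u := by
    intro u hsu hu
    rcases le_total b u with h | h
    · have h1 := hwait u h hu
      have h2 := S.hpWork_add k hsb h
      nlinarith
    · have h1 := S.hpWork_le k h
      have h2 := S.hpWork_add k hsu h
      nlinarith [mul_pos hM' hρT]
  choose a ha m hcomp harel hpend using fun i => exists_busy_start S ω i s
  refine ⟨b + (τ k).T - s, by simp only [ge_iff_le]; linarith, fun i => s - a i,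
    fun i => sub_nonneg.2 (ha i), fun t ht0 ht => ?_⟩
  have h := hdemand (s + t) (by linarith) (by linarith)
  rw [add_sub_cancel_left] at h
  refine h.trans_le (Finset.sum_le_sum fun i hi => ?_)
  have hik : i ≤ k := (Finset.mem_Iio.1 hi).le
  have h1 := hS.taskRun_le_of_no_backlog (hcomp i) (harel i) (s + t)
  have h2 := occupation_add (S.measurableSet_taskRun i) (ha i) (by linarith : s ≤ s + t)
  -- By minimality of `s`, the density on `[a i, s)` is below `M * (1 - ρ)`. So the pending task `i`
  -- waits less than a fraction `1 - ρ` of that interval, and runs for at least `ρ` of it.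
  have h3 : (τ i).U * (s - a i) ≤ occupation (S.taskRun i) (a i) s := by
    rcases (ha i).eq_or_lt with heq | hlt
    · rw [heq, sub_self, mul_zero]; exact occupation_nonneg _ _ _
    · have e1 := hS.mul_waiting_le_hpWork hik (ha i) (hpend i)
      have e2 := hearly (a i) hlt
      have e3 := S.hpWork_add k (ha i) hsb
      have e4 : M * (s - a i - occupation (S.taskRun i) (a i) s)
          < M * ((1 - ρ) * (s - a i)) := by nlinarith
      have e5 := lt_of_mul_lt_mul_left e4 hM'.le
      have e6 := mul_le_mul_of_nonneg_right (hρ i hik) (sub_nonneg.2 (ha i))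
      linarith
  have e : s + t - a i = t + (s - a i) := by ring
  rw [e] at h1
  linarith

end Schedule

/-! ### Schedulability. -/

/-- The quadratic utilization bound for global rate-monotonic scheduling. -/
theorem schedulable_of_quadratic_bound {n : ℕ} (τ : Fin n → SporadicTask) {M : ℕ} (hM : 0 < M)
    (hD : ImplicitDeadlines τ) (hRM : RateMonotonic τ) {k : Fin n} (hk : (Finset.Iio k).Nonempty)
    (hsum : ∑ i ∈ Finset.Iio k, (τ i).U ≤ M)
    (h : maxUtil τ k ≤ 1 - 2 / M * ∑ i ∈ Finset.Iio k, (τ i).U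
      + 0.5 / M ^ 2 * ((∑ i ∈ Finset.Iio k, (τ i).U) ^ 2 + ∑ i ∈ Finset.Iio k, (τ i).U ^ 2)) :
    Schedulable τ M k := by
  have hM' : (0 : ℝ) < M := by exact_mod_cast hM
  have hUpos : ∀ i, 0 < (τ i).U := fun i => div_pos (τ i).C_pos (τ i).T_pos
  have hρ : ∀ i ≤ k, (τ i).U ≤ maxUtil τ k := fun i hi =>
    Finset.le_sup' (fun i => (τ i).U) (Finset.mem_Iic.2 hi)
  -- Strictness makes the density `M * (1 - ρ)` positive. Both squares are at most `M * σ`, so the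
  -- right side of `h` is at most `1 - σ / M`.
  have hρ1 : maxUtil τ k < 1 := by
    refine h.trans_lt ?_
    have hpos : 0 < ∑ i ∈ Finset.Iio k, (τ i).U := Finset.sum_pos (fun i _ => hUpos i) hk
    have hsq : ∑ i ∈ Finset.Iio k, (τ i).U ^ 2 ≤ (∑ i ∈ Finset.Iio k, (τ i).U) ^ 2 :=
      Finset.sum_sq_le_sq_sum_of_nonneg fun i _ => (hUpos i).le
    set σ := ∑ i ∈ Finset.Iio k, (τ i).U
    have h1 : 0.5 / (M : ℝ) ^ 2 * (σ ^ 2 + ∑ i ∈ Finset.Iio k, (τ i).U ^ 2)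
        ≤ 0.5 / (M : ℝ) ^ 2 * (2 * (M * σ)) :=
      mul_le_mul_of_nonneg_left (by nlinarith) (by positivity)
    have h2 : 0.5 / (M : ℝ) ^ 2 * (2 * (M * σ)) = σ / M := by field_simp; norm_num
    have h3 : 2 / (M : ℝ) * σ = 2 * (σ / M) := by ring
    have h4 : 0 < σ / M := div_pos hpos hM'
    linarith
  intro ω S hS j
  induction j using Nat.strong_induction_on with
  | _ j ih =>
    by_contra hmiss
    have hdl : ∀ l, ω.deadline k l = ω.release k l + (τ k).T := fun l => by
      rw [JobSequence.deadline, hD k]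
    rw [hdl] at hmiss
    -- With implicit deadlines, earlier jobs that meet their deadlines are finished by the release
    -- of job `j`.
    have hprev : ∀ l < j, S.Completed ω k l (ω.release k j) := fun l hl =>
      (ih l hl).mono (by
        rw [hdl]
        exact (ω.release_sep k l).trans (ω.release_mono k hl))
    obtain ⟨θ, hθ, φ, hφ, hdem⟩ := hS.exists_demand_of_miss hM hρ hρ1 hprev hmiss
    exact absurd h (not_le.2 (quadratic_bound_of_demand (Finset.Iio k) τ M (maxUtil τ k) θ φ hM'
      ((τ k).T_pos.trans_le hθ) hk (fun i _ => hφ i)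
      (fun i hi => (hRM i k (Finset.mem_Iio.1 hi)).trans hθ) hdem hsum))

end GlobalSched

theorem theorem3 {n : ℕ} (τ : Fin n → GlobalSched.SporadicTask) (M : ℕ) (hM : 0 < M)
    (hD : GlobalSched.ImplicitDeadlines τ) (hRM : GlobalSched.RateMonotonic τ)
    (k : Fin n) (hk : 2 ≤ GlobalSched.rank k)
    (h :
      ((∑ i ∈ Finset.Iio k, (τ i).U ≤ (M : ℝ)) ∧
        GlobalSched.maxUtil τ k ≤
          1 - (2 / (M : ℝ)) * ∑ i ∈ Finset.Iio k, (τ i).U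
            + (0.5 / (M : ℝ) ^ 2) *
              ((∑ i ∈ Finset.Iio k, (τ i).U) ^ 2 + ∑ i ∈ Finset.Iio k, (τ i).U ^ 2)) ∨
      (∑ i ∈ Finset.Iio k, (τ i).U) / (M : ℝ) ≤
        (((GlobalSched.rank k : ℝ) - 1) / (GlobalSched.rank k : ℝ)) *
          (2 - Real.sqrt (2 + 2 * GlobalSched.maxUtil τ k *
            ((GlobalSched.rank k : ℝ) / ((GlobalSched.rank k : ℝ) - 1))))) :
    GlobalSched.Schedulable τ M k := by
  have hcard : (Finset.Iio k).card = (k : ℕ) := Fin.card_Iio k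
  have hne : (Finset.Iio k).Nonempty := by
    rw [← Finset.card_pos, hcard]
    unfold GlobalSched.rank at hk
    omega
  have hUpos : ∀ i, 0 < (τ i).U := fun i => div_pos (τ i).C_pos (τ i).T_pos
  have h' := h.elim id fun h2 =>
    GlobalSched.quadratic_bound_of_sqrt_bound (Finset.Iio k) (fun i => (τ i).U) M
      (GlobalSched.maxUtil τ k) (by exact_mod_cast hM)
      ((hUpos k).le.trans (Finset.le_sup' (fun i => (τ i).U) (Finset.mem_Iic.2 le_rfl)))
      hne (fun i _ => (hUpos i).le)
      (by rw [hcard]; simp [GlobalSched.rank]) h2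
  exact GlobalSched.schedulable_of_quadratic_bound τ hM hD hRM hne h'.1 h'.2
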